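/- Let $\mathfrak{H}^1=\mathbb{Q}\langle z_k\mid k\ge 1\rangle$ be the free (noncommutative) $\mathbb{Q}$-algebra on the variables $z_1,z_2,z_3,\dots$. Let $*$ be the $\mathbb{Q}$-bilinear harmonic product on $\mathfrak{H}^1$, defined by $w*1=1*w=w$ and $$z_kw*z_lw'=z_k(w*z_lw')+z_l(z_kw*w')+z_{k+l}(w*w')\qquad(k,l\ge 1,\ w,w'\in\mathfrak{H}^1),$$ and write $\mathfrak{H}^1_*$ for the unitary commutative $\mathbb{Q}$-algebra $(\mathfrak{H}^1,*)$. For $m\ge 0$ let $Z_m\colon\mathfrak{H}^1\to\mathbb{Q}$ be the $\mathbb{Q}$-linear map with $Z_m(1)=1$ and $$Z_m(z_{k_1}\cdots z_{k_n})=\sum_{m\ge m_1>\cdots>m_n>0}\frac{1}{m_1^{k_1}\cdots m_n^{k_n}}\qquad(n\ge 1,\ k_1,\dots,k_n\ge 1),$$ an empty sum being $0$. Then the map $$\mathcal{Z}\colon\mathfrak{H}^1_*\longrightarrow\mathbb{Q}^{\mathbb{N}},\qquad w\longmapsto\{Z_m(w)\}_{m\ge 0},$$ where $\mathbb{Q}^{\mathbb{N}}$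 is the $\mathbb{Q}$-algebra of rational sequences with termwise operations, is a $\mathbb{Q}$-algebra homomorphism and is injective. -/

import Mathlib

noncomputable section

namespace Harmonic

/-- The free (noncommutative) `ℚ`-algebra `ℚ⟨z_k ∣ k ≥ 1⟩`, with the concatenation product. -/
abbrev H1 : Type := FreeAlgebra ℚ ℕ+

/-- The generator `z_k`. -/
def z (k : ℕ+) : H1 := FreeAlgebra.ι ℚ k

/-- The word `z_{k_1} ⋯ z_{k_n}`. -/
def word (k : List ℕ+) : H1 := (k.map z).prod

/-- The words form a `ℚ`-basis (see `wordBasis_apply`). -/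
def wordBasis : Module.Basis (List ℕ+) ℚ H1 :=
  (FreeAlgebra.basisFreeMonoid ℚ ℕ+).reindex FreeMonoid.toList

theorem wordBasis_apply (k : List ℕ+) : wordBasis k = word k := by
  have h : (FreeAlgebra.basisFreeMonoid ℚ ℕ+) (FreeMonoid.ofList k) = word k := by
    simp [FreeAlgebra.basisFreeMonoid, FreeAlgebra.equivMonoidAlgebraFreeMonoid, word,
      FreeMonoid.lift_apply]
    rfl
  rw [← h]; simp [wordBasis]

theorem word_nil : word [] = 1 := rfl

theorem word_cons (k : ℕ+) (u : List ℕ+) : word (k :: u) = z k * word u := by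
  simp [word]

/-- The harmonic product of two words, by its defining recursion. -/
def harmonicWord : List ℕ+ → List ℕ+ → H1
  | [], v => word v
  | k :: u, [] => word (k :: u)
  | k :: u, l :: v =>
      z k * harmonicWord u (l :: v) + z l * harmonicWord (k :: u) v
        + z (k + l) * harmonicWord u v
termination_by u v => u.length + v.length

/-- The harmonic product: the `ℚ`-bilinear extension of `harmonicWord`. -/
def harmonicMul : H1 →ₗ[ℚ] H1 →ₗ[ℚ] H1 :=
  wordBasis.constr ℚ fun u => wordBasis.constr ℚ fun v => harmonicWord u v

theorem harmonicMul_word (u v : List ℕ+) :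
    harmonicMul (word u) (word v) = harmonicWord u v := by
  simp only [← wordBasis_apply, harmonicMul, Module.Basis.constr_basis]

/-- Linear maps agreeing on all words agree. -/
theorem hom_ext {M : Type*} [AddCommMonoid M] [Module ℚ M] {f g : H1 →ₗ[ℚ] M}
    (h : ∀ u, f (word u) = g (word u)) : f = g :=
  wordBasis.ext fun u => by rw [wordBasis_apply, h]

theorem one_harmonicMul (w : H1) : harmonicMul 1 w = w := by
  have : harmonicMul 1 = LinearMap.id := hom_ext fun v => by
    rw [← word_nil, harmonicMul_word, harmonicWord]; rfl
  rw [this]; rfl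

theorem harmonicMul_one (w : H1) : harmonicMul w 1 = w := by
  have : harmonicMul.flip 1 = LinearMap.id := hom_ext fun v => by
    rw [LinearMap.flip_apply, ← word_nil, harmonicMul_word]
    cases v <;> rw [harmonicWord] <;> rfl
  exact LinearMap.congr_fun this w

theorem harmonicMul_z_mul (k l : ℕ+) (w w' : H1) :
    harmonicMul (z k * w) (z l * w') =
      z k * harmonicMul w (z l * w') + z l * harmonicMul (z k * w) w'
        + z (k + l) * harmonicMul w w' := by
  let L (k : ℕ+) : H1 →ₗ[ℚ] H1 := LinearMap.mulLeft ℚ (z k)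
  have : harmonicMul.compl₁₂ (L k) (L l) =
      (harmonicMul.compl₁₂ LinearMap.id (L l)).compr₂ (L k)
        + (harmonicMul.compl₁₂ (L k) LinearMap.id).compr₂ (L l)
        + harmonicMul.compr₂ (L (k + l)) := by
    refine hom_ext fun u => hom_ext fun v => ?_
    simp only [L, LinearMap.compl₁₂_apply, LinearMap.add_apply, LinearMap.compr₂_apply,
      LinearMap.mulLeft_apply, LinearMap.id_apply, ← word_cons, harmonicMul_word]
    rw [harmonicWord]
  exact LinearMap.congr_fun₂ this w w'

theorem harmonicMul_comm (w w' : H1) : harmonicMul w w' = harmonicMul w' w := by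
  have : harmonicMul = harmonicMul.flip := by
    refine hom_ext fun u => hom_ext fun v => ?_
    rw [LinearMap.flip_apply]
    induction u generalizing v with
    | nil => rw [word_nil, one_harmonicMul, harmonicMul_one]
    | cons k u ihu =>
      induction v with
      | nil => rw [word_nil, one_harmonicMul, harmonicMul_one]
      | cons l v ihv =>
        rw [word_cons] at ihv
        rw [word_cons, word_cons, harmonicMul_z_mul, harmonicMul_z_mul, ← word_cons l,
          ihu, ihv, ihu, word_cons l, add_comm l k]
        abel
  exact LinearMap.congr_fun₂ this w w'

theorem harmonicMul_assoc_word (u v t : List ℕ+) :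
    harmonicMul (harmonicMul (word u) (word v)) (word t) =
      harmonicMul (word u) (harmonicMul (word v) (word t)) := by
  induction u generalizing v t with
  | nil => rw [word_nil, one_harmonicMul, one_harmonicMul]
  | cons a u ihu =>
    induction v generalizing t with
    | nil => rw [word_nil, harmonicMul_one, one_harmonicMul]
    | cons b v ihv =>
      induction t with
      | nil => rw [word_nil, harmonicMul_one, harmonicMul_one]
      | cons c t iht =>
        have h1 := ihu (b :: v) (c :: t)
        have h2 := ihv (c :: t)
        have h3 := ihu v (c :: t)
        have h4 := ihu (b :: v) t
        have h5 := ihv t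
        have h6 := ihu v t
        simp only [word_cons, harmonicMul_z_mul, map_add, LinearMap.add_apply]
          at h1 h2 h3 h4 h5 h6 iht ⊢
        replace iht := congrArg (z c * ·) iht
        simp only [mul_add, add_assoc a b c, h1, h2, h3, h4, h5, h6] at iht ⊢
        linear_combination (norm := abel) iht

theorem harmonicMul_assoc (x y w : H1) :
    harmonicMul (harmonicMul x y) w = harmonicMul x (harmonicMul y w) := by
  have h1 (u v : List ℕ+) : harmonicMul (harmonicMul (word u) (word v)) =
      harmonicMul (word u) ∘ₗ harmonicMul (word v) :=
    hom_ext fun t => harmonicMul_assoc_word u v t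
  have h2 (u : List ℕ+) : harmonicMul.flip w ∘ₗ harmonicMul (word u) =
      harmonicMul (word u) ∘ₗ harmonicMul.flip w :=
    hom_ext fun v => LinearMap.congr_fun (h1 u v) w
  have h3 : harmonicMul.flip w ∘ₗ harmonicMul.flip y =
      harmonicMul.flip (harmonicMul y w) :=
    hom_ext fun u => LinearMap.congr_fun (h2 u) y
  exact LinearMap.congr_fun h3 x

/-- The harmonic algebra: the vector space `H1` with the harmonic product. -/
def HarmonicAlgebra : Type := H1

instance : AddCommGroup HarmonicAlgebra := inferInstanceAs (AddCommGroup H1)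

instance : Module ℚ HarmonicAlgebra := inferInstanceAs (Module ℚ H1)

/-- The identity map from `H1` to the harmonic algebra. -/
def toHarmonic : H1 ≃ₗ[ℚ] HarmonicAlgebra := LinearEquiv.refl ℚ H1

instance : CommRing HarmonicAlgebra :=
  { (inferInstance : AddCommGroup HarmonicAlgebra) with
    mul := fun x y => toHarmonic (harmonicMul (toHarmonic.symm x) (toHarmonic.symm y))
    one := toHarmonic 1
    zero_mul := fun x => LinearMap.map_zero₂ harmonicMul x
    mul_zero := fun x => map_zero (harmonicMul x)
    left_distrib := fun x y w => map_add (harmonicMul x) y w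
    right_distrib := fun x y w => LinearMap.map_add₂ harmonicMul x y w
    one_mul := one_harmonicMul
    mul_one := harmonicMul_one
    mul_assoc := harmonicMul_assoc
    mul_comm := harmonicMul_comm }

instance : Algebra ℚ HarmonicAlgebra :=
  Algebra.ofModule (fun r x y => LinearMap.map_smul₂ harmonicMul r x y)
    (fun r x y => map_smul (harmonicMul x) r y)

open Classical in
/-- The truncated multiple zeta sum: the sum of `1 / (m_1 ^ k_1 ⋯ m_n ^ k_n)` over
`m ≥ m_1 > ⋯ > m_n > 0`. -/
def truncatedZeta (m : ℕ) (k : List ℕ+) : ℚ :=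
  ∑ s ∈ (Fintype.piFinset fun _ : Fin k.length => Finset.Icc 1 m) with StrictAnti s,
    1 / ∏ i, (s i : ℚ) ^ (k.get i : ℕ)

/-- The `ℚ`-linear map `Z_m` with `Z_m(z_{k_1} ⋯ z_{k_n}) = ζ_m(k_1, …, k_n)`. -/
def Z (m : ℕ) : H1 →ₗ[ℚ] ℚ := wordBasis.constr ℚ (truncatedZeta m)

end Harmonic

end

open Filter Polynomial

namespace Harmonic

/-! Multiplicativity is an induction on `m`: since `Z_succ_z_mul` adds one term `(m + 1)⁻ᵏ Z m w`,
expanding a product of two such sums reproduces the harmonic recursion.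

For injectivity, `truncatedZeta_independent` proves more: the sums are independent over rational
functions of `m`, considered for large `m`. In a relation over a suffix-closed set of words, make
the coefficient of a longest word `k₀ :: u` equal to 1 and take differences in `m`. That word drops
out, so by induction every coefficient of the differenced relation vanishes. Hence the coefficients
of all `k :: u` are eventually constants `c k`, with `c k₀ = 1`, and that of `u` is a rational
function with difference `-∑ c k (m + 1)⁻ᵏ`. This is impossible by `no_simple_pole_difference`: the
difference of a rational function cannot have a single pole. -/

/-! ### Recursion in the truncation, and multiplicativity -/

theorem truncatedZeta_nil (m : ℕ) : truncatedZeta m [] = 1 := by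
  classical
  unfold truncatedZeta
  rw [Finset.sum_eq_single (fun i : Fin ([] : List ℕ+).length => Fin.elim0 i)]
  · simp
  · intro b _ hb
    exact absurd (_root_.funext fun i : Fin 0 => i.elim0) hb
  · intro h
    exact absurd (Finset.mem_filter.2 ⟨Fintype.mem_piFinset.2 fun i : Fin 0 => i.elim0,
      fun i : Fin 0 => i.elim0⟩) h

theorem truncatedZeta_zero_cons (k : ℕ+) (u : List ℕ+) : truncatedZeta 0 (k :: u) = 0 := by
  classical
  unfold truncatedZeta
  apply Finset.sum_eq_zero
  intro s hs
  have := (Fintype.mem_piFinset.1 (Finset.mem_filter.1 hs).1) ⟨0, by simp⟩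
  simp at this

/-- Split by whether the largest index equals `m + 1`; if it does, the other indices form a strictly
decreasing tuple bounded by `m`. -/
theorem truncatedZeta_succ_cons (m : ℕ) (k : ℕ+) (u : List ℕ+) :
    truncatedZeta (m + 1) (k :: u) =
      truncatedZeta m (k :: u) + ((m : ℚ) + 1)⁻¹ ^ (k : ℕ) * truncatedZeta m u := by
  classical
  unfold truncatedZeta
  change ∑ s ∈ (Fintype.piFinset fun _ : Fin (u.length + 1) => Finset.Icc 1 (m + 1)) with
      StrictAnti s, 1 / ∏ i : Fin (u.length + 1), (s i : ℚ) ^ ((k :: u).get i : ℕ) =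
    ∑ s ∈ (Fintype.piFinset fun _ : Fin (u.length + 1) => Finset.Icc 1 m) with
      StrictAnti s, 1 / ∏ i : Fin (u.length + 1), (s i : ℚ) ^ ((k :: u).get i : ℕ) + _
  rw [← Finset.sum_filter_not_add_sum_filter _ (fun s : Fin (u.length + 1) → ℕ => s 0 = m + 1)]
  congr 1
  · refine Finset.sum_congr ?_ fun _ _ => rfl
    ext s
    simp only [Finset.mem_filter, Fintype.mem_piFinset, Finset.mem_Icc]
    constructor
    · rintro ⟨⟨h, hs⟩, h0⟩
      refine ⟨fun i => ⟨(h i).1, ?_⟩, hs⟩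
      have h1 := hs.antitone (Fin.zero_le i)
      have h2 := (h 0).2
      omega
    · rintro ⟨h, hs⟩
      refine ⟨⟨fun i => ⟨(h i).1, (h i).2.trans (Nat.le_succ m)⟩, hs⟩, ?_⟩
      have h2 := (h 0).2
      omega
  · rw [Finset.mul_sum]
    refine Finset.sum_bij' (fun s _ => Fin.tail s)
      (fun s _ => (Fin.cons (m + 1) s : Fin (u.length + 1) → ℕ)) ?_ ?_ ?_ ?_ ?_
    · intro s hs
      simp only [Finset.mem_filter, Fintype.mem_piFinset, Finset.mem_Icc] at hs ⊢
      obtain ⟨⟨h, hs⟩, h0⟩ := hs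
      refine ⟨fun i => ⟨(h _).1, ?_⟩, fun i j hij => hs (Fin.succ_lt_succ_iff.2 hij)⟩
      have := hs (Fin.succ_pos i)
      simp only [Fin.tail]
      omega
    · intro s hs
      simp only [Finset.mem_filter, Fintype.mem_piFinset, Finset.mem_Icc] at hs ⊢
      obtain ⟨h, hs⟩ := hs
      refine ⟨⟨fun i => ?_, fun i j hij => ?_⟩, rfl⟩
      · refine Fin.cases ?_ (fun i => ?_) i
        · simp
        · simpa using ⟨(h i).1, (h i).2.trans (Nat.le_succ m)⟩
      · induction j using Fin.cases with
        | zero => simp at hij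
        | succ j =>
          induction i using Fin.cases with
          | zero => simpa using Nat.lt_succ_of_le (h j).2
          | succ i => simpa using hs (Fin.succ_lt_succ_iff.1 hij)
    · intro s hs
      rw [← (Finset.mem_filter.1 hs).2]
      exact Fin.cons_self_tail s
    · intro s hs
      exact Fin.tail_cons (α := fun _ => ℕ) _ _
    · intro s hs
      have h0 := (Finset.mem_filter.1 hs).2
      rw [Fin.prod_univ_succ, h0]
      simp [Fin.tail, mul_comm]

theorem Z_word (m : ℕ) (u : List ℕ+) : Z m (word u) = truncatedZeta m u := by
  rw [← wordBasis_apply, Z, Module.Basis.constr_basis]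

theorem Z_one (m : ℕ) : Z m 1 = 1 := by
  rw [← word_nil, Z_word, truncatedZeta_nil]

theorem Z_zero_z_mul (k : ℕ+) (w : H1) : Z 0 (z k * w) = 0 := by
  have : Z 0 ∘ₗ LinearMap.mulLeft ℚ (z k) = 0 := hom_ext fun u => by
    simp [← word_cons, Z_word, truncatedZeta_zero_cons]
  exact LinearMap.congr_fun this w

theorem Z_succ_z_mul (m : ℕ) (k : ℕ+) (w : H1) :
    Z (m + 1) (z k * w) = Z m (z k * w) + ((m : ℚ) + 1)⁻¹ ^ (k : ℕ) * Z m w := by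
  have : Z (m + 1) ∘ₗ LinearMap.mulLeft ℚ (z k) =
      Z m ∘ₗ LinearMap.mulLeft ℚ (z k) + ((m : ℚ) + 1)⁻¹ ^ (k : ℕ) • Z m := hom_ext fun u => by
    simp only [LinearMap.comp_apply, LinearMap.mulLeft_apply, LinearMap.add_apply,
      LinearMap.smul_apply, smul_eq_mul, ← word_cons, Z_word, truncatedZeta_succ_cons]
  exact LinearMap.congr_fun this w

theorem Z_harmonicMul (m : ℕ) (w w' : H1) : Z m (harmonicMul w w') = Z m w * Z m w' := by
  have (m : ℕ) : harmonicMul.compr₂ (Z m) = (LinearMap.mul ℚ ℚ).compl₁₂ (Z m) (Z m) := by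
    induction m with
    | zero =>
      refine hom_ext fun u => hom_ext fun v => ?_
      simp only [LinearMap.compr₂_apply, LinearMap.compl₁₂_apply, LinearMap.mul_apply']
      rcases u with _ | ⟨k, u⟩
      · rw [word_nil, one_harmonicMul, Z_one, one_mul]
      rcases v with _ | ⟨l, v⟩
      · rw [word_nil, harmonicMul_one, Z_one, mul_one]
      simp [word_cons, harmonicMul_z_mul, Z_zero_z_mul]
    | succ m ih =>
      have ih (w w' : H1) : Z m (harmonicMul w w') = Z m w * Z m w' :=
        LinearMap.congr_fun₂ ih w w'
      refine hom_ext fun u => hom_ext fun v => ?_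
      simp only [LinearMap.compr₂_apply, LinearMap.compl₁₂_apply, LinearMap.mul_apply']
      rcases u with _ | ⟨k, u⟩
      · rw [word_nil, one_harmonicMul, Z_one, one_mul]
      rcases v with _ | ⟨l, v⟩
      · rw [word_nil, harmonicMul_one, Z_one, mul_one]
      -- Of the four products in the expansion, this accounts for the one without a power of `(m +
      -- 1)⁻¹`; the other three match the three harmonic terms.
      have h := ih (z k * word u) (z l * word v)
      simp only [word_cons, harmonicMul_z_mul, map_add, Z_succ_z_mul, ih, PNat.add_coe, pow_add]
        at h ⊢
      linear_combination h
  exact LinearMap.congr_fun₂ (this m) w w'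

/-! ### Eventually rational sequences -/

/-- Sequences that agree eventually with a rational function. -/
def EventuallyRational (f : ℕ → ℚ) : Prop :=
  ∃ P Q : ℚ[X], Q ≠ 0 ∧ ∀ᶠ m : ℕ in atTop, f m = P.eval (m : ℚ) / Q.eval (m : ℚ)

theorem eventually_eval_ne_zero {P : ℚ[X]} (hP : P ≠ 0) :
    ∀ᶠ m : ℕ in atTop, P.eval (m : ℚ) ≠ 0 := by
  have h : {m : ℕ | P.eval (m : ℚ) = 0}.Finite := by
    have := (P.rootSet_finite ℚ).preimage (Nat.cast_injective (R := ℚ)).injOn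
    refine this.subset fun m hm => ?_
    simpa [mem_rootSet, hP] using hm
  rw [← Nat.cofinite_eq_atTop]
  exact h.compl_mem_cofinite

theorem eq_of_eventually_eval_eq {P Q : ℚ[X]}
    (h : ∀ᶠ m : ℕ in atTop, P.eval (m : ℚ) = Q.eval (m : ℚ)) : P = Q := by
  by_contra hne
  obtain ⟨m, h1, h2⟩ := (h.and (eventually_eval_ne_zero (sub_ne_zero.2 hne))).exists
  exact h2 (by simp [h1])

namespace EventuallyRational

variable {f g : ℕ → ℚ}

theorem const (c : ℚ) : EventuallyRational fun _ => c :=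
  ⟨C c, 1, one_ne_zero, by simp⟩

theorem add (hf : EventuallyRational f) (hg : EventuallyRational g) :
    EventuallyRational fun m => f m + g m := by
  obtain ⟨P, Q, hQ, h⟩ := hf
  obtain ⟨P', Q', hQ', h'⟩ := hg
  refine ⟨P * Q' + Q * P', Q * Q', mul_ne_zero hQ hQ', ?_⟩
  filter_upwards [h, h', eventually_eval_ne_zero hQ, eventually_eval_ne_zero hQ'] with m h h' q q'
  rw [h, h', eval_add, eval_mul, eval_mul, eval_mul, div_add_div _ _ q q']

theorem mul (hf : EventuallyRational f) (hg : EventuallyRational g) :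
    EventuallyRational fun m => f m * g m := by
  obtain ⟨P, Q, hQ, h⟩ := hf
  obtain ⟨P', Q', hQ', h'⟩ := hg
  refine ⟨P * P', Q * Q', mul_ne_zero hQ hQ', ?_⟩
  filter_upwards [h, h'] with m h h'
  rw [h, h', eval_mul, eval_mul, div_mul_div_comm]

theorem sub (hf : EventuallyRational f) (hg : EventuallyRational g) :
    EventuallyRational fun m => f m - g m := by
  simpa [sub_eq_add_neg] using hf.add ((const (-1)).mul hg)

theorem sum {ι : Type*} (s : Finset ι) {F : ι → ℕ → ℚ}
    (h : ∀ i ∈ s, EventuallyRational (F i)) : EventuallyRational fun m => ∑ i ∈ s, F i m := by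
  classical
  induction s using Finset.induction_on with
  | empty => simpa using const 0
  | insert i s hi ih =>
    simp only [Finset.sum_insert hi]
    exact (h i (Finset.mem_insert_self i s)).add
      (ih fun j hj => h j (Finset.mem_insert_of_mem hj))

theorem shift (hf : EventuallyRational f) : EventuallyRational fun m => f (m + 1) := by
  obtain ⟨P, Q, hQ, h⟩ := hf
  refine ⟨P.comp (X + 1), Q.comp (X + 1), ?_, ?_⟩
  · simpa using (comp_X_add_C_ne_zero_iff (t := (1 : ℚ))).2 hQ
  · filter_upwards [(tendsto_add_atTop_nat 1).eventually h] with m h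
    simpa using h

theorem inv_succ_pow (k : ℕ) : EventuallyRational fun m => ((m : ℚ) + 1)⁻¹ ^ k := by
  refine ⟨1, (X + 1) ^ k, pow_ne_zero _ ?_, by simp⟩
  simpa using X_add_C_ne_zero (1 : ℚ)

/-- A nonzero numerator has finitely many roots. This dichotomy permits division by a leading
coefficient, as in a field. -/
theorem eventually_eq_zero_or (hf : EventuallyRational f) :
    (∀ᶠ m in atTop, f m = 0) ∨
      (∀ᶠ m in atTop, f m ≠ 0) ∧ EventuallyRational fun m => (f m)⁻¹ := by
  obtain ⟨P, Q, hQ, h⟩ := hf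
  by_cases hP : P = 0
  · left
    filter_upwards [h] with m h
    simp [h, hP]
  · right
    refine ⟨?_, Q, P, hP, ?_⟩
    · filter_upwards [h, eventually_eval_ne_zero hQ, eventually_eval_ne_zero hP] with m h q p
      rw [h]
      exact div_ne_zero p q
    · filter_upwards [h] with m h
      rw [h, inv_div]

end EventuallyRational

/-! ### Poles of differences of rational functions -/

/-- The set of integer roots of a nonzero polynomial is finite. -/
theorem finite_int_roots {P : ℚ[X]} (hP : P ≠ 0) : {a : ℤ | P.eval (a : ℚ) = 0}.Finite := by
  have := (P.rootSet_finite ℚ).preimage (Int.cast_injective (α := ℚ)).injOn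
  refine this.subset fun m hm => ?_
  simpa [mem_rootSet, hP] using hm

/-- The difference `R(x) - R(x - 1)` of a rational function `R = P / Q` does not have `0` as its
only pole. -/
theorem no_simple_pole_difference {P Q F : ℚ[X]} {M : ℕ} (hM : M ≠ 0) (hQ : Q ≠ 0)
    (hPQ : IsCoprime P Q) (hF : F.eval 0 ≠ 0)
    (h : ∀ x : ℚ, x ^ M * (P.eval x * Q.eval (x - 1) - P.eval (x - 1) * Q.eval x) =
      Q.eval x * Q.eval (x - 1) * F.eval x) : False := by
  have hne (x : ℚ) (hx : Q.eval x = 0) : P.eval x ≠ 0 := by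
    intro hp
    obtain ⟨a, b, hab⟩ := hPQ
    simpa [hx, hp] using congrArg (eval x) hab
  have h0 := h 0
  rw [zero_pow hM, zero_mul] at h0
  have hfin := finite_int_roots hQ
  rcases mul_eq_zero.1 ((mul_eq_zero.1 h0.symm).resolve_right hF) with hr | hr
  · have hr' : (0 : ℤ) ∈ {a : ℤ | Q.eval (a : ℚ) = 0} := by simpa using hr
    -- At the largest integer root `a ≥ 0` of `Q`, the pole of `R(x - 1)` at `x = a + 1` is not
    -- cancelled by `R(x)`, and `a + 1 ≠ 0`.
    obtain ⟨a, hmax'⟩ := hfin.exists_maximal ⟨0, hr'⟩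
    have ha' : Q.eval (a : ℚ) = 0 := hmax'.prop
    have hmax {y : ℤ} (hy : Q.eval (y : ℚ) = 0) (h : a ≤ y) : y ≤ a := hmax'.le_of_ge hy h
    have ha0 : 0 ≤ a := (le_total 0 a).elim id fun h => hmax (by simpa using hr) h
    have ha1 : Q.eval ((a : ℚ) + 1) ≠ 0 := fun hz => by
      have := hmax (y := a + 1) (by simpa using hz) (by omega)
      omega
    have hx := h (a + 1)
    have hpos : ((a : ℚ) + 1) ^ M ≠ 0 := pow_ne_zero _ (by positivity)
    simp [ha', hpos, hne _ ha', ha1] at hx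
  · have hr' : (-1 : ℤ) ∈ {a : ℤ | Q.eval (a : ℚ) = 0} := by simpa using hr
    -- Symmetrically, at the smallest integer root `a ≤ -1` the pole of `R(x)` survives.
    obtain ⟨a, hmin'⟩ := hfin.exists_minimal ⟨-1, hr'⟩
    have ha' : Q.eval (a : ℚ) = 0 := hmin'.prop
    have hmin {y : ℤ} (hy : Q.eval (y : ℚ) = 0) (h : y ≤ a) : a ≤ y := hmin'.le_of_le hy h
    have ha0 : a ≤ -1 := (le_total a (-1)).elim id fun h => hmin (by simpa using hr) h
    have ha1 : Q.eval ((a : ℚ) - 1) ≠ 0 := fun hz => by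
      have := hmin (y := a - 1) (by simpa using hz) (by omega)
      omega
    have hx := h a
    have hz : (a : ℚ) ^ M ≠ 0 := pow_ne_zero _ (by exact_mod_cast (by omega : a ≠ 0))
    simp [ha', hne _ ha', ha1] at hx
    omega

theorem EventuallyRational.exists_coprime {f : ℕ → ℚ} (hf : EventuallyRational f) :
    ∃ P Q : ℚ[X], Q ≠ 0 ∧ IsCoprime P Q ∧
      ∀ᶠ m : ℕ in atTop, f m = P.eval (m : ℚ) / Q.eval (m : ℚ) := by
  obtain ⟨P, Q, hQ, hPQ⟩ := hf
  obtain ⟨P', Q', D, hrel, rfl, rfl⟩ :=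
    UniqueFactorizationMonoid.exists_reduced_factors' P Q hQ
  refine ⟨P', Q', right_ne_zero_of_mul hQ, hrel.isCoprime, ?_⟩
  filter_upwards [hPQ, eventually_eval_ne_zero (left_ne_zero_of_mul hQ)] with m hm hz
  rw [hm, eval_mul, eval_mul, mul_div_mul_left _ _ hz]

/-- No nontrivial combination of the sequences `(m + 1)⁻ᵏ`, `k ≥ 1`, is the difference sequence of
a rational function. -/
theorem EventuallyRational.coeff_eq_zero_of_difference {f : ℕ → ℚ} (hf : EventuallyRational f)
    (T : Finset ℕ+) (c : ℕ+ → ℚ)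
    (h : ∀ᶠ m : ℕ in atTop, f (m + 1) - f m = ∑ k ∈ T, c k * ((m : ℚ) + 1)⁻¹ ^ (k : ℕ)) :
    ∀ k ∈ T, c k = 0 := by
  classical
  by_contra! hc
  obtain ⟨k₀, hk₀, hc₀⟩ := hc
  have hT : (T.filter fun k => c k ≠ 0).Nonempty := ⟨k₀, by simp [hk₀, hc₀]⟩
  obtain ⟨S, hS⟩ : ∃ S, S = T.filter fun k => c k ≠ 0 := ⟨_, rfl⟩
  rw [← hS] at hT
  -- `M` is the largest exponent with nonzero coefficient, the order of the pole at 0 in `x = m +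
  -- 1`, so `F` has constant term `c M`.
  obtain ⟨M, hM, hle⟩ : ∃ M ∈ S, ∀ k ∈ S, (k : ℕ) ≤ M := S.exists_max_image _ hT
  obtain ⟨P, Q, hQ, hcop, hPQ⟩ := hf.exists_coprime
  let F : ℚ[X] := ∑ k ∈ S, C (c k) * X ^ ((M : ℕ) - k)
  have hF : F.eval 0 ≠ 0 := by
    have : F.eval 0 = c M := by
      simp only [F, eval_finsetSum, eval_mul, eval_C, eval_pow, eval_X]
      rw [Finset.sum_eq_single M _ (fun h => absurd hM h)]
      · simp
      · intro k hk hkM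
        have : (k : ℕ) ≠ M := fun h => hkM (PNat.coe_injective h)
        have := hle k hk
        rw [zero_pow (by omega), mul_zero]
    rw [this]
    rw [hS] at hM
    exact (Finset.mem_filter.1 hM).2
  have key : X ^ (M : ℕ) * (P * Q.comp (X - 1) - P.comp (X - 1) * Q) =
      Q * Q.comp (X - 1) * F := by
    apply eq_of_eventually_eval_eq
    rw [← map_add_atTop_eq_nat 1, eventually_map]
    have hsucc := tendsto_add_atTop_nat 1
    filter_upwards [h, hPQ, hsucc.eventually hPQ, eventually_eval_ne_zero hQ,
      hsucc.eventually (eventually_eval_ne_zero hQ)] with m h h1 h2 q1 q2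
    rw [h1, h2] at h
    have hm : (m : ℚ) + 1 ≠ 0 := by positivity
    have hsum : ((m : ℚ) + 1) ^ (M : ℕ) * ∑ k ∈ T, c k * ((m : ℚ) + 1)⁻¹ ^ (k : ℕ) =
        F.eval ((m : ℚ) + 1) := by
      have : ∑ k ∈ T, c k * ((m : ℚ) + 1)⁻¹ ^ (k : ℕ) =
          ∑ k ∈ S, c k * ((m : ℚ) + 1)⁻¹ ^ (k : ℕ) := by
        rw [hS, Finset.sum_filter]
        exact Finset.sum_congr rfl fun k _ => by split_ifs with h <;> simp_all
      rw [this]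
      simp only [F, eval_finsetSum, eval_mul, eval_C, eval_pow, eval_X, Finset.mul_sum]
      refine Finset.sum_congr rfl fun k hk => ?_
      rw [pow_sub₀ _ hm (hle k hk), inv_pow]
      ring
    push_cast at h q2 ⊢
    simp only [eval_mul, eval_pow, eval_X, eval_sub, eval_comp, eval_one, add_sub_cancel_right]
    rw [← hsum, ← h]
    field_simp
  refine no_simple_pole_difference M.ne_zero hQ hcop hF fun x => ?_
  simpa using congrArg (eval x) key

/-! ### Independence over rational functions, and injectivity -/

/-- Truncated multiple zeta sums of distinct words are linearly independent over the rational
functions of the truncation. -/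
theorem truncatedZeta_independent (n : ℕ) : ∀ (S : Finset (List ℕ+)), S.card = n →
    (∀ k u, k :: u ∈ S → u ∈ S) → ∀ (R : List ℕ+ → ℕ → ℚ), (∀ w ∈ S, EventuallyRational (R w)) →
    (∀ᶠ m in atTop, ∑ w ∈ S, R w m * truncatedZeta m w = 0) →
    ∀ w ∈ S, ∀ᶠ m in atTop, R w m = 0 := by
  classical
  induction n with
  | zero =>
    intro S hS _ _ _ _ w hw
    simp_all
  | succ n ih =>
    intro S hcard htail R hR hrel
    have hne : S.Nonempty := Finset.card_pos.1 (by omega)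
    obtain ⟨w₀, hw₀, hmax⟩ := S.exists_max_image List.length hne
    have hcard' : (S.erase w₀).card = n := by rw [Finset.card_erase_of_mem hw₀]; omega
    have htail' : ∀ k u, k :: u ∈ S.erase w₀ → u ∈ S.erase w₀ := by
      intro k u hu
      refine Finset.mem_erase.2 ⟨?_, htail k u (Finset.mem_of_mem_erase hu)⟩
      rintro rfl
      have := hmax _ (Finset.mem_of_mem_erase hu)
      simp at this
    rcases (hR w₀ hw₀).eventually_eq_zero_or with h0 | ⟨h0, hinv⟩
    · have := ih (S.erase w₀) hcard' htail' R (fun w hw => hR w (Finset.mem_of_mem_erase hw)) (by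
        filter_upwards [hrel, h0] with m h1 h2
        rwa [← Finset.add_sum_erase _ _ hw₀, h2, zero_mul, zero_add] at h1)
      intro w hw
      by_cases hww : w = w₀
      · rwa [hww]
      · exact this w (Finset.mem_erase.2 ⟨hww, hw⟩)
    exfalso
    -- Extension by 0 outside `S` lets `f (k :: w)` be used for every `k`.
    let f (w : List ℕ+) (m : ℕ) : ℚ := if w ∈ S then R w m * (R w₀ m)⁻¹ else 0
    have hf (w) : EventuallyRational (f w) := by
      by_cases hw : w ∈ S
      · simpa [f, hw] using (hR w hw).mul hinv
      · simpa [f, hw] using EventuallyRational.const 0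
    have hfS (w) (hw : w ∉ S) (m : ℕ) : f w m = 0 := if_neg hw
    have hf0 : ∀ᶠ m in atTop, f w₀ m = 1 := by
      filter_upwards [h0] with m hm
      simp [f, hw₀, hm]
    have hfrel : ∀ᶠ m in atTop, ∑ w ∈ S, f w m * truncatedZeta m w = 0 := by
      filter_upwards [hrel] with m hm
      rw [← zero_mul (R w₀ m)⁻¹, ← hm, Finset.sum_mul]
      refine Finset.sum_congr rfl fun w hw => ?_
      simp only [f, if_pos hw]
      ring
    let K : Finset ℕ+ := S.biUnion List.toFinset
    -- The coefficient of `truncatedZeta m w` in the differenced relation.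
    let g (w : List ℕ+) (m : ℕ) : ℚ :=
      f w (m + 1) - f w m + ∑ k ∈ K, f (k :: w) (m + 1) * ((m : ℚ) + 1)⁻¹ ^ (k : ℕ)
    have hg (w) : EventuallyRational (g w) :=
      ((hf w).shift.sub (hf w)).add (EventuallyRational.sum _ fun k _ =>
        (hf _).shift.mul (EventuallyRational.inv_succ_pow k))
    have hdiff (m : ℕ) : ∑ w ∈ S, g w m * truncatedZeta m w =
        ∑ w ∈ S, f w (m + 1) * truncatedZeta (m + 1) w - ∑ w ∈ S, f w m * truncatedZeta m w := by
      let d (w : List ℕ+) : ℚ :=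
        f w (m + 1) * (truncatedZeta (m + 1) w - truncatedZeta m w)
      -- Both sums extend to the union of their index sets: `f` vanishes off `S`, and the only word
      -- of `S` that is not a `k :: u` is empty, with constant sum.
      have hd : ∑ w ∈ S, d w = ∑ p ∈ K ×ˢ S, d (p.1 :: p.2) := by
        rw [← Finset.sum_image (f := d) (g := fun p : ℕ+ × List ℕ+ => p.1 :: p.2)
          fun p _ q _ h => Prod.ext (List.cons.inj h).1 (List.cons.inj h).2]
        rw [Finset.sum_subset (Finset.subset_union_left (s₂ := Finset.image _ (K ×ˢ S)))
          fun w _ hw => by simp only [d, hfS w hw, zero_mul]]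
        refine (Finset.sum_subset Finset.subset_union_right fun w hw hw' => ?_).symm
        rcases w with _ | ⟨k, u⟩
        · simp only [d, truncatedZeta_nil, sub_self, mul_zero]
        · have hkS := (Finset.mem_union.1 hw).resolve_right hw'
          exact absurd (Finset.mem_image.2 ⟨(k, u), Finset.mem_product.2
            ⟨Finset.mem_biUnion.2 ⟨_, hkS, by simp⟩, htail k u hkS⟩, rfl⟩) hw'
      have hd' (k) (u) : d (k :: u) =
          f (k :: u) (m + 1) * ((m : ℚ) + 1)⁻¹ ^ (k : ℕ) * truncatedZeta m u := by
        simp only [d, truncatedZeta_succ_cons]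
        ring
      rw [Finset.sum_product_right] at hd
      simp only [hd'] at hd
      simp only [← Finset.sum_mul] at hd
      rw [← Finset.sum_sub_distrib]
      simp only [g, add_mul, Finset.sum_add_distrib]
      rw [← hd, ← Finset.sum_add_distrib]
      exact Finset.sum_congr rfl fun w _ => by simp only [d]; ring
    have hlong (w) (hw : w.length = w₀.length) (k : ℕ+) (m : ℕ) : f (k :: w) m = 0 := by
      refine hfS _ (fun h => ?_) m
      have := hmax _ h
      simp at this
      omega
    have hglong (w) (hw : w.length = w₀.length) (m : ℕ) : g w m = f w (m + 1) - f w m := by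
      simp [g, hlong w hw]
    have hsucc := tendsto_add_atTop_nat 1
    -- The coefficient of `w₀` has become `1 - 1 = 0`.
    have hg0 := ih (S.erase w₀) hcard' htail' g (fun w _ => hg w) (by
      filter_upwards [hfrel, hsucc.eventually hfrel, hf0, hsucc.eventually hf0] with m h1 h2 h3 h4
      have := hdiff m
      rwa [← Finset.add_sum_erase _ _ hw₀, hglong w₀ rfl, h1, h2, h3, h4, sub_self, sub_self,
        zero_mul, zero_add] at this)
    -- If the longest word is empty, the relation reads `1 = 0`.
    rcases w₀ with _ | ⟨k₀, u⟩
    · obtain ⟨m, h1, h2⟩ := (hfrel.and hf0).exists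
      rw [Finset.sum_eq_single [] _ (fun h => absurd hw₀ h), h2, truncatedZeta_nil] at h1
      · simp at h1
      · intro w hw hw'
        exact absurd (List.length_eq_zero_iff.1 (Nat.le_zero.1 (hmax w hw))) hw'
    have hconst (k : ℕ+) : ∃ c : ℚ, ∀ᶠ m in atTop, f (k :: u) m = c := by
      by_cases hk : k :: u ∈ S.erase (k₀ :: u)
      · obtain ⟨N, hN⟩ := eventually_atTop.1 (hg0 _ hk)
        refine ⟨f (k :: u) N, eventually_atTop.2 ⟨N, fun m hm => ?_⟩⟩
        induction m, hm using Nat.le_induction with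
        | base => rfl
        | succ m hm h =>
          have := hN m hm
          rw [hglong _ (by simp)] at this
          rw [← h]
          linarith
      · by_cases hk0 : k = k₀
        · exact ⟨1, hk0 ▸ hf0⟩
        · exact ⟨0, Eventually.of_forall (hfS _ fun h => hk (Finset.mem_erase.2 ⟨by simpa, h⟩))⟩
    choose c hc using hconst
    have hu : u ∈ S.erase (k₀ :: u) := Finset.mem_erase.2 ⟨by simp, htail _ _ hw₀⟩
    have hcz := (hf u).coeff_eq_zero_of_difference K (fun k => - c k) (by
      have hc' : ∀ᶠ m in atTop, ∀ k ∈ K, f (k :: u) (m + 1) = c k :=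
        (Filter.eventually_all_finset K).2 fun k _ => hsucc.eventually (hc k)
      filter_upwards [hg0 u hu, hc'] with m h1 h2
      have h3 : ∑ k ∈ K, f (k :: u) (m + 1) * ((m : ℚ) + 1)⁻¹ ^ (k : ℕ) =
          ∑ k ∈ K, c k * ((m : ℚ) + 1)⁻¹ ^ (k : ℕ) :=
        Finset.sum_congr rfl fun k hk => by rw [h2 k hk]
      simp only [g, h3] at h1
      simp only [neg_mul, Finset.sum_neg_distrib]
      linarith)
    have hk₀ : k₀ ∈ K := Finset.mem_biUnion.2 ⟨_, hw₀, by simp⟩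
    obtain ⟨m, h1, h2⟩ := ((hc k₀).and hf0).exists
    have := hcz k₀ hk₀
    linarith

theorem eq_zero_of_forall_Z_eq_zero (w : H1) (h : ∀ m, Z m w = 0) : w = 0 := by
  classical
  let c := wordBasis.repr w
  -- Suffix closure of the support, because differencing passes from `k :: u` to `u`.
  let S : Finset (List ℕ+) := c.support.biUnion fun l => l.tails.toFinset
  have hS : c.support ⊆ S := fun l hl => Finset.mem_biUnion.2 ⟨l, hl, by simp⟩
  have hrel (m : ℕ) : ∑ u ∈ S, c u * truncatedZeta m u = 0 := by
    rw [← h m, Z, Module.Basis.constr_apply, Finsupp.sum]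
    symm
    refine Finset.sum_subset hS fun u _ hu => ?_
    rw [Finsupp.notMem_support_iff.1 hu, zero_smul]
  have hc := truncatedZeta_independent _ S rfl (by
    intro k u hu
    obtain ⟨l, hl, hul⟩ := Finset.mem_biUnion.1 hu
    refine Finset.mem_biUnion.2 ⟨l, hl, ?_⟩
    simp only [List.mem_toFinset, List.mem_tails] at hul ⊢
    exact (List.suffix_cons k u).trans hul) (fun u _ => c u)
    (fun u _ => EventuallyRational.const (c u)) (Eventually.of_forall hrel)
  refine wordBasis.repr.map_eq_zero_iff.1 (Finsupp.ext fun u => ?_)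
  by_cases hu : u ∈ S
  · exact (hc u hu).exists.choose_spec
  · exact Finsupp.notMem_support_iff.1 fun h => hu (hS h)

/-- The map sending `w` to the sequence of its truncated multiple zeta sums. -/
noncomputable def zetaSequence : HarmonicAlgebra →ₐ[ℚ] (ℕ → ℚ) :=
  AlgHom.ofLinearMap (LinearMap.pi fun m => Z m ∘ₗ toHarmonic.symm.toLinearMap)
    (funext fun m => Z_one m) fun x y => funext fun m => Z_harmonicMul m x y

end Harmonic

theorem theorem4 :
    ∃ 𝒵 : Harmonic.HarmonicAlgebra →ₐ[ℚ] (ℕ → ℚ),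
      (∀ (w : Harmonic.H1) (m : ℕ), 𝒵 (Harmonic.toHarmonic w) m = Harmonic.Z m w) ∧
      Function.Injective 𝒵 :=
  ⟨Harmonic.zetaSequence, fun _ _ => rfl, (injective_iff_map_eq_zero _).2 fun w hw =>
    Harmonic.eq_zero_of_forall_Z_eq_zero w fun m => congrFun hw m⟩
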